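/- A ribbon graph $G=(V,E)$ is a surface with boundary represented as the union of two finite sets of discs, the vertices $V$ and the edges $E$, such that vertices and edges intersect in disjoint line segments, each such segment lies on the boundary of precisely one vertex and precisely one edge, and every edge contains exactly two such segments; ribbon graphs are considered up to homeomorphisms preserving this structure. $G$ may be disconnected and non-orientable. For $A\subseteq E$, let $(V,A)$ be the spanning ribbon subgraph with edge set $A$, and let $k(A)$ and $f(A)$ be its numbers of connected components and of boundary components; put $k(G)=k(E)$ and $e(G)=|E|$. The subgraph $(V,A)$ is a spanning quasi-tree of $G$ if $k(A)=k(G)$ and every connected component of $(V,A)$ has exactly one boundary component. Let $\mathcal F$ be the set of edge sets of spanning quasi-trees of $G$, and let $D(G)=(E,\mathcal F)$ be the delta-matroid of $G$, with Bouchet's rank function \[\rho_{D(G)}(A)=|E|-\min\{|A\bigtriangleup F| : F\in\mathcal F\}.\] An edge-toggle replaces a spanning ribbon subgraph $(V,B)$ by $(V,B\bigtriangleup\{e\})$ for some $e\in E$. Theorem. Let $G=(V,E)$ be a ribbon graph. Then $\mathcal F\neq\emptyset$, and for every $A\subseteq E$ \[\rho_{D(G)}(A)=e(G)-f(A)+k(G);\]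 moreover, $|E|-\rho_{D(G)}(A)$ is the minimum number of edge-toggles needed to transform $(V,A)$ into a spanning quasi-tree of $G$. -/

import Mathlib

/-!
Ribbon graphs, up to equivalence, as discs glued along line segments.

Every edge disc `e` is a rectangle: it has two ends (labelled by a `Bool`), which are the line
segments along which it meets the vertex discs, and two free sides (labelled by a `Bool`), each
joining one end to the other.  A *corner* `(e, i, s)` is the endpoint, on the side `s`, of the line
segment at the end `i` of `e`.  The line segments are pairwise disjoint, so all corners are
distinct points, and they cut the boundary circles of the discs into arcs.
-/

/-- The corners of the edge discs: `(edge, end, side)`. -/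
abbrev Corner (E : Type*) := E × Bool × Bool

namespace Corner

/-- The other endpoint of the line segment at `x`. -/
def across {E : Type*} (x : Corner E) : Corner E := (x.1, x.2.1, !x.2.2)

/-- The other endpoint of the free side of the edge disc at `x`. -/
def along {E : Type*} (x : Corner E) : Corner E := (x.1, !x.2.1, x.2.2)

end Corner

/-- A ribbon graph with vertex set `V` and edge set `E`.

The boundary circle of a vertex disc is cut by the line segments that lie on it into these
segments and the arcs between consecutive ones; `arc x` is the other endpoint of the arc that
starts at the corner `x`. Hence every boundary circle of a vertex disc that carries a segment is a
single cycle that alternates between segments (`Corner.across`) and arcs (`arc`).  Vertices that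
are not of the form `inc e i` are isolated.  Twisted edges are allowed, so the surface need not be
orientable. -/
structure RibbonGraph (V E : Type*) where
  /-- the vertex disc that the end `i` of the edge disc `e` is attached to -/
  inc : E → Bool → V
  /-- the other endpoint of the vertex boundary arc starting at a corner -/
  arc : Corner E → Corner E
  arc_arc : ∀ x, arc (arc x) = x
  arc_ne : ∀ x, arc x ≠ x
  /-- an arc lies on the boundary of one vertex disc -/
  inc_arc : ∀ x, inc (arc x).1 (arc x).2.1 = inc x.1 x.2.1
  /-- the segments and arcs on the boundary of one vertex disc form a single circle -/
  circle : ∀ x y : Corner E, inc x.1 x.2.1 = inc y.1 y.2.1 →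
    Relation.EqvGen (fun a b => b = arc a ∨ b = a.across) x y

namespace RibbonGraph

variable {V E : Type*} (G : RibbonGraph V E)

/-- The connected components of the spanning ribbon subgraph `(V, A)`: vertices modulo the
equivalence relation generated by adjacency through an edge in `A`. -/
def Component (A : Finset E) : Type _ :=
  Quot (fun u v : V => ∃ e ∈ A, u = G.inc e false ∧ v = G.inc e true)

/-- `k(A)`: the number of connected components of `(V, A)`. -/
noncomputable def k (A : Finset E) : ℕ := Nat.card (G.Component A)

/-- The places where the boundary of `(V, A)` is sampled: all corners, and one point on the
boundary circle of every vertex disc without corners. -/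
abbrev BoundaryPoint : Type _ := Corner E ⊕ {v : V // ∀ e i, G.inc e i ≠ v}

/-- The boundary of the surface `(V, A)`, as a subset of `G`, consists of
* all arcs of the vertex discs between consecutive line segments of `G`,
* the line segments of the edges outside `A` (no edge disc of `(V, A)` is glued there),
* the two free sides of every edge in `A`,
* the boundary circles of the vertices that are isolated in `G`. -/
inductive BoundaryStep (A : Finset E) : G.BoundaryPoint → G.BoundaryPoint → Prop
  | arc (x : Corner E) : BoundaryStep A (Sum.inl x) (Sum.inl (G.arc x))
  | segment (x : Corner E) (h : x.1 ∉ A) : BoundaryStep A (Sum.inl x) (Sum.inl x.across)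
  | side (x : Corner E) (h : x.1 ∈ A) : BoundaryStep A (Sum.inl x) (Sum.inl x.along)

/-- The boundary components of the spanning ribbon subgraph `(V, A)`. -/
def BoundaryComponent (A : Finset E) : Type _ := Quot (G.BoundaryStep A)

/-- `f(A)`: the number of boundary components of `(V, A)`. -/
noncomputable def f (A : Finset E) : ℕ := Nat.card (G.BoundaryComponent A)

/-- The vertex disc that contains a given boundary point. -/
def vertexAt : G.BoundaryPoint → V
  | Sum.inl x => G.inc x.1 x.2.1
  | Sum.inr v => v.1

theorem component_eq_of_step (A : Finset E) (p q : G.BoundaryPoint) (h : G.BoundaryStep A p q) :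
    (Quot.mk _ (G.vertexAt p) : G.Component A) = Quot.mk _ (G.vertexAt q) := by
  cases h with
  | arc x => exact congrArg _ (G.inc_arc x).symm
  | segment x h => rfl
  | side x h =>
    obtain ⟨e, i, s⟩ := x
    cases i
    · exact Quot.sound ⟨e, h, rfl, rfl⟩
    · exact (Quot.sound ⟨e, h, rfl, rfl⟩).symm

/-- The connected component of `(V, A)` on whose boundary a given boundary component lies. -/
def BoundaryComponent.component {G : RibbonGraph V E} {A : Finset E} :
    G.BoundaryComponent A → G.Component A :=
  Quot.lift (fun p => Quot.mk _ (G.vertexAt p)) (G.component_eq_of_step A)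

/-- `(V, A)` is a spanning quasi-tree of `G`: it has as many connected components as `G`, and each
of its components has exactly one boundary component. -/
def IsSpanningQuasiTree [Fintype E] (A : Finset E) : Prop :=
  G.k A = G.k Finset.univ ∧ ∀ c : G.Component A, ∃! b : G.BoundaryComponent A, b.component = c

end RibbonGraph

/-- A set system on the ground set `E`, given by its feasible sets. -/
structure SetSystem (E : Type*) where
  feasible : Set (Finset E)

/-- Bouchet's rank `ρ_D(A) = |E| - min {|A ∆ F| : F feasible}`; the minimum is taken over a
nonempty set when `D` is proper, i.e. has a feasible set. -/
noncomputable def SetSystem.rank {E : Type*} [Fintype E] [DecidableEq E] (D : SetSystem E)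
    (A : Finset E) : ℤ :=
  (Fintype.card E : ℤ) - (sInf {n : ℕ | ∃ F ∈ D.feasible, n = (symmDiff A F).card} : ℕ)

/-- `D(G)`: the feasible sets are the edge sets of the spanning quasi-trees of `G`. -/
def RibbonGraph.deltaMatroid {V E : Type*} [Fintype E] (G : RibbonGraph V E) : SetSystem E where
  feasible := {F | G.IsSpanningQuasiTree F}

/-- `Toggles n A B`: the spanning ribbon subgraph `(V, B)` arises from `(V, A)` by a sequence of
`n` edge-toggles. -/
inductive Toggles {E : Type*} [DecidableEq E] : ℕ → Finset E → Finset E → Prop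
  | refl (A : Finset E) : Toggles 0 A A
  | step {n : ℕ} {A B : Finset E} (e : E) (h : Toggles n A B) :
      Toggles (n + 1) A (symmDiff B {e})

/-! Every boundary component lies on a component of `(V, A)`, so `k(G) ≤ k(A) ≤ f(A)`, and the
spanning quasi-trees are exactly the `A` with `f(A) = k(G)` (`isSpanningQuasiTree_iff`). One toggle
lowers `f` by at most one (`f_le_f_toggle_add_one`), so at least `f(A) - k(G)` toggles are needed.

Conversely, if no edge meets two boundary components, each component of `G` carries only one, so
`f(A) ≤ k(G)` (`f_le_k_univ`). Otherwise toggling an edge that meets two merges them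
(`f_toggle_lt`), and iterating reaches a quasi-tree in exactly `f(A) - k(G)` toggles. Bouchet's
minimum is this same number, since `|A ∆ F|` is the least number of toggles from `A` to `F`. -/

/-- Identifying two points of a finite type lowers its cardinality by at most one. -/
theorem Nat.card_le_card_quot_pair_add_one {α : Type*} [Finite α] (p q : α) :
    Nat.card α ≤ Nat.card (Quot fun u v : α => u = p ∧ v = q) + 1 := by
  classical
  have hfin : Finite (Quot fun u v : α => u = p ∧ v = q) :=
    Finite.of_surjective _ Quot.mk_surjective
  rw [← Finite.card_option]
  let g : (Quot fun u v : α => u = p ∧ v = q) → α :=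
    Quot.lift (fun a => if a = q then p else a) (by
      rintro a b ⟨rfl, rfl⟩
      simp)
  refine Nat.card_le_card_of_injective
    (fun a : α => if a = q then none else some (Quot.mk (fun u v : α => u = p ∧ v = q) a)) ?_
  intro a b hab
  by_cases ha : a = q <;> by_cases hb : b = q
  · rw [ha, hb]
  · simp [ha, hb] at hab
  · simp [ha, hb] at hab
  · simp only [ha, hb, if_false, Option.some.injEq] at hab
    have := congrArg g hab
    simpa [g, ha, hb] using this

/-- Identifying two distinct points of a finite type lowers its cardinality. -/
theorem Nat.card_quot_pair_lt {α : Type*} [Finite α] {p q : α} (h : p ≠ q) :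
    Nat.card (Quot fun u v : α => u = p ∧ v = q) < Nat.card α := by
  have hfin : Finite (Quot fun u v : α => u = p ∧ v = q) :=
    Finite.of_surjective _ Quot.mk_surjective
  by_contra! hle
  have hbij := Function.Surjective.bijective_of_nat_card_le
    (f := Quot.mk fun u v : α => u = p ∧ v = q) Quot.mk_surjective hle
  exact h (hbij.1 (Quot.sound ⟨rfl, rfl⟩))

/-- A finite set with a fixed-point-free involution has an even number of elements. -/
theorem Finset.even_card_of_involution {α : Type*} (s : Finset α) (g : α → α)
    (hmem : ∀ a ∈ s, g a ∈ s) (hne : ∀ a ∈ s, g a ≠ a) (hg : ∀ a ∈ s, g (g a) = a) :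
    Even s.card := by
  have h : ∑ _a ∈ s, (1 : ZMod 2) = 0 :=
    Finset.sum_involution (fun a _ => g a) (fun _ _ => by decide) (fun a ha _ => hne a ha)
      (fun a ha => hmem a ha) (fun a ha => hg a ha)
  rw [Finset.sum_const, nsmul_one] at h
  exact (ZMod.natCast_eq_zero_iff_even).1 h

namespace RibbonGraph

variable {V E : Type*} (G : RibbonGraph V E)

/-! ### Components against boundary components -/

section counting

variable (A : Finset E)

/-- The boundary component of `(V, A)` through a corner. -/
def boundaryAt (x : Corner E) : G.BoundaryComponent A := Quot.mk _ (Sum.inl x)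

theorem boundaryAt_arc (x : Corner E) : G.boundaryAt A (G.arc x) = G.boundaryAt A x :=
  (Quot.sound (BoundaryStep.arc x)).symm

instance [Finite V] [Finite E] : Finite (G.BoundaryComponent A) :=
  Finite.of_surjective _ Quot.mk_surjective

instance [Finite V] : Finite (G.Component A) :=
  Finite.of_surjective _ Quot.mk_surjective

theorem vertexAt_surjective : Function.Surjective G.vertexAt := by
  intro v
  by_cases h : ∀ e i, G.inc e i ≠ v
  · exact ⟨Sum.inr ⟨v, h⟩, rfl⟩
  · push Not at h
    obtain ⟨e, i, rfl⟩ := h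
    exact ⟨Sum.inl (e, i, false), rfl⟩

theorem component_surjective :
    Function.Surjective (BoundaryComponent.component (G := G) (A := A)) := by
  rintro ⟨v⟩
  obtain ⟨p, rfl⟩ := G.vertexAt_surjective v
  exact ⟨Quot.mk _ p, rfl⟩

theorem k_le_f [Finite V] [Finite E] : G.k A ≤ G.f A :=
  Nat.card_le_card_of_surjective _ (G.component_surjective A)

theorem k_univ_le_k [Finite V] [Fintype E] : G.k Finset.univ ≤ G.k A := by
  refine Nat.card_le_card_of_surjective
    (Quot.map id fun u v ⟨e, _, h⟩ => ⟨e, Finset.mem_univ e, h⟩ :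
      G.Component A → G.Component Finset.univ) ?_
  rintro ⟨v⟩
  exact ⟨Quot.mk _ v, rfl⟩

/-- Equality of the outer terms in `k(G) ≤ k(A) ≤ f(A)` forces both equalities, and a surjection
between finite sets of equal size is bijective. -/
theorem isSpanningQuasiTree_iff [Finite V] [Fintype E] :
    G.IsSpanningQuasiTree A ↔ G.f A = G.k Finset.univ := by
  unfold IsSpanningQuasiTree
  rw [← Function.bijective_iff_existsUnique]
  constructor
  · rintro ⟨hk, hb⟩
    rw [← hk]
    exact Nat.card_eq_of_bijective _ hb
  · intro h
    have h₁ := G.k_le_f A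
    have h₂ := G.k_univ_le_k A
    exact ⟨by omega, (G.component_surjective A).bijective_of_nat_card_le
      (by change G.f A ≤ G.k A; omega)⟩

end counting

/-- The corner joined to `x` by the part of the boundary of `(V, A)` on the edge of `x`. -/
def mate [DecidableEq E] (A : Finset E) (x : Corner E) : Corner E :=
  if x.1 ∈ A then x.along else x.across

/-! ### Toggling one edge -/

section mate

variable [DecidableEq E] (A : Finset E)

@[simp] theorem mate_fst (x : Corner E) : (mate A x).1 = x.1 := by
  unfold mate; split_ifs <;> rfl

theorem mate_mate (x : Corner E) : mate A (mate A x) = x := by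
  obtain ⟨e, i, s⟩ := x
  by_cases h : e ∈ A <;> simp [mate, Corner.along, Corner.across, h]

theorem mate_ne (x : Corner E) : mate A x ≠ x := by
  obtain ⟨e, i, s⟩ := x
  by_cases h : e ∈ A <;> simp [mate, Corner.along, Corner.across, h]

theorem mate_comm (B : Finset E) (x : Corner E) : mate A (mate B x) = mate B (mate A x) := by
  obtain ⟨e, i, s⟩ := x
  by_cases h : e ∈ A <;> by_cases h' : e ∈ B <;>
    simp [mate, Corner.along, Corner.across, h, h']

theorem mate_toggle_of_ne {e : E} {x : Corner E} (h : x.1 ≠ e) :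
    mate (symmDiff A {e}) x = mate A x := by
  simp [mate, Finset.mem_symmDiff, h]

/-- Toggling `e` swaps the roles of `along` and `across` on its corners; these commuting involutions
act simply transitively on the four corners. -/
theorem eq_of_fst_eq {e : E} {x y : Corner E} (hx : x.1 = e) (hy : y.1 = e) :
    y = x ∨ y = mate A x ∨ y = mate (symmDiff A {e}) x ∨
      y = mate A (mate (symmDiff A {e}) x) := by
  obtain ⟨e, i, s⟩ := x
  obtain ⟨e', j, t⟩ := y
  subst hx
  subst hy
  by_cases h : e' ∈ A <;> cases i <;> cases j <;> cases s <;> cases t <;>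
    simp [mate, Corner.along, Corner.across, h, Finset.mem_symmDiff]

theorem boundaryAt_mate (x : Corner E) : G.boundaryAt A (mate A x) = G.boundaryAt A x := by
  unfold mate
  split_ifs with h
  · exact (Quot.sound (BoundaryStep.side x h)).symm
  · exact (Quot.sound (BoundaryStep.segment x h)).symm

variable {G A} in
theorem eq_of_boundaryStep {α : Sort*} (F : G.BoundaryPoint → α)
    (harc : ∀ x, F (Sum.inl (G.arc x)) = F (Sum.inl x))
    (hmate : ∀ x, F (Sum.inl (mate A x)) = F (Sum.inl x))
    {p q : G.BoundaryPoint} (h : G.BoundaryStep A p q) : F p = F q := by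
  cases h with
  | arc x => exact (harc x).symm
  | segment x h => simpa [mate, h] using (hmate x).symm
  | side x h => simpa [mate, h] using (hmate x).symm

/-- A toggle of `e` lowers the number of boundary components by at most one. -/
theorem f_le_f_toggle_add_one [Finite V] [Finite E] (e : E) :
    G.f A ≤ G.f (symmDiff A {e}) + 1 := by
  let x : Corner E := (e, false, false)
  let B := symmDiff A {e}
  let r : G.BoundaryComponent A → G.BoundaryComponent A → Prop :=
    fun u v => u = G.boundaryAt A x ∧ v = G.boundaryAt A (mate B x)
  -- The four corners of `e` meet at most the two components of `(V, A)` fused by `r`; once these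
  -- are fused, the new connections at `e` change nothing.
  have hfuse : Nat.card (G.BoundaryComponent A) ≤ Nat.card (Quot r) + 1 :=
    Nat.card_le_card_quot_pair_add_one _ _
  refine hfuse.trans (Nat.add_le_add_right ?_ 1)
  have hcorner : ∀ y : Corner E, y.1 = e →
      (Quot.mk r (G.boundaryAt A y)) = Quot.mk r (G.boundaryAt A x) := by
    intro y hy
    have h : Quot.mk r (G.boundaryAt A (mate B x)) = Quot.mk r (G.boundaryAt A x) :=
      (Quot.sound ⟨rfl, rfl⟩).symm
    rcases eq_of_fst_eq A (x := x) rfl hy with rfl | rfl | rfl | rfl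
    · rfl
    · rw [boundaryAt_mate]
    · exact h
    · rw [boundaryAt_mate]; exact h
  let φ : G.BoundaryComponent B → Quot r :=
    Quot.lift (fun p => Quot.mk r (Quot.mk _ p)) (fun p q h =>
      eq_of_boundaryStep (A := B) (fun p => Quot.mk r (Quot.mk (G.BoundaryStep A) p))
        (fun y => congrArg (Quot.mk r) (G.boundaryAt_arc A y))
        (fun y => by
          by_cases hy : y.1 = e
          · exact (hcorner _ (by simpa using hy)).trans (hcorner y hy).symm
          · rw [mate_toggle_of_ne A hy]
            exact congrArg (Quot.mk r) (G.boundaryAt_mate A y)) h)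
  refine Nat.card_le_card_of_surjective φ ?_
  rintro ⟨⟨p⟩⟩
  exact ⟨Quot.mk _ p, rfl⟩

/-- A part of the boundary closed under arcs and under the mates of corners outside the edge `e`
contains an even number of the corners of `e`. -/
theorem even_card_corners (e : E) (C : Finset (Corner E))
    (harc : ∀ y ∈ C, G.arc y ∈ C) (hmate : ∀ y ∈ C, y.1 ≠ e → mate A y ∈ C) :
    Even (C.filter fun y => y.1 = e).card := by
  have hC : Even C.card :=
    C.even_card_of_involution G.arc harc (fun y _ => G.arc_ne y) (fun y _ => G.arc_arc y)
  have hrest : Even (C.filter fun y => ¬ y.1 = e).card := by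
    refine Finset.even_card_of_involution _ (mate A) ?_ (fun y _ => mate_ne A y)
      (fun y _ => mate_mate A y)
    intro y hy
    rw [Finset.mem_filter] at hy ⊢
    exact ⟨hmate y hy.1 hy.2, by simpa using hy.2⟩
  rw [← Finset.card_filter_add_card_filter_not (s := C) (fun y => y.1 = e)] at hC
  exact (Nat.even_add.1 hC).2 hrest

/-- If the edge `e` meets two boundary components of `(V, A)`, cutting it off at a corner `y`
leaves the boundary arc from `y` to its mate, which survives in the toggled subgraph. -/
theorem boundaryAt_toggle_mate [Finite E] {e : E} {y : Corner E} (hy : y.1 = e)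
    (h : G.boundaryAt A (mate (symmDiff A {e}) y) ≠ G.boundaryAt A y) :
    G.boundaryAt (symmDiff A {e}) (mate A y) = G.boundaryAt (symmDiff A {e}) y := by
  classical
  have := Fintype.ofFinite E
  let B := symmDiff A {e}
  -- Away from `e` the mates for `A` and `B` agree, so this intersection of an `A`-component with a
  -- `B`-component satisfies the parity lemma.
  let C : Finset (Corner E) := Finset.univ.filter fun z =>
    G.boundaryAt A z = G.boundaryAt A y ∧ G.boundaryAt B z = G.boundaryAt B y
  have hyC : y ∈ C := by simp [C]
  have heven : Even (C.filter fun z => z.1 = e).card := by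
    refine even_card_corners G A e C (fun z hz => ?_) (fun z hz hze => ?_)
    · simpa [C, boundaryAt_arc] using hz
    · have hz' : G.boundaryAt B (mate A z) = G.boundaryAt B z := by
        rw [← mate_toggle_of_ne A hze]
        exact G.boundaryAt_mate B z
      simpa [C, boundaryAt_mate, hz'] using hz
  -- Otherwise `y` is the only corner of `e` in `C`: `mate A y` is in another `B`-component, the
  -- remaining two corners in another `A`-component.
  by_contra hne
  have hsingle : (C.filter fun z => z.1 = e) = {y} := by
    ext z
    rw [Finset.mem_filter, Finset.mem_singleton]
    constructor
    · rintro ⟨hzC, hze⟩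
      simp only [C, Finset.mem_filter, Finset.mem_univ, true_and] at hzC
      rcases eq_of_fst_eq A hy hze with rfl | rfl | rfl | rfl
      · rfl
      · exact absurd hzC.2 hne
      · exact absurd hzC.1 h
      · rw [boundaryAt_mate] at hzC
        exact absurd hzC.1 h
    · rintro rfl
      exact ⟨hyC, hy⟩
  rw [hsingle] at heven
  simp at heven

/-- Toggling an edge that meets two boundary components merges them. -/
theorem f_toggle_lt [Finite V] [Finite E] {e : E} {x : Corner E} (hx : x.1 = e)
    (h : G.boundaryAt A x ≠ G.boundaryAt A (mate (symmDiff A {e}) x)) :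
    G.f (symmDiff A {e}) < G.f A := by
  let B := symmDiff A {e}
  let r : G.BoundaryComponent A → G.BoundaryComponent A → Prop :=
    fun u v => u = G.boundaryAt A x ∧ v = G.boundaryAt A (mate B x)
  have hfuse : Nat.card (Quot r) < Nat.card (G.BoundaryComponent A) := Nat.card_quot_pair_lt h
  refine lt_of_le_of_lt ?_ hfuse
  have := Finite.of_surjective _ (Quot.mk_surjective (r := r))
  have hne : ∀ y : Corner E, y.1 = e → G.boundaryAt A (mate B y) ≠ G.boundaryAt A y := by
    intro y hy
    rcases eq_of_fst_eq A hx hy with rfl | rfl | rfl | rfl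
    · exact h.symm
    · rw [← mate_comm, boundaryAt_mate, boundaryAt_mate]
      exact h.symm
    · rw [mate_mate]
      exact h
    · rw [← mate_comm, mate_mate, boundaryAt_mate, boundaryAt_mate]
      exact h
  -- The `A`-connections lost at `e` are still realised in `B`, by the parity argument, so the
  -- components of `A` map onto those of `B`.
  let ψ : G.BoundaryComponent A → G.BoundaryComponent B :=
    Quot.lift (Quot.mk _) (fun p q hpq =>
      eq_of_boundaryStep (A := A) (Quot.mk (G.BoundaryStep B)) (G.boundaryAt_arc B)
        (fun y => by
          by_cases hy : y.1 = e
          · exact G.boundaryAt_toggle_mate A hy (hne y hy)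
          · rw [← mate_toggle_of_ne A hy]
            exact G.boundaryAt_mate B y) hpq)
  let φ : Quot r → G.BoundaryComponent B := Quot.lift ψ (by
    rintro _ _ ⟨rfl, rfl⟩
    exact (G.boundaryAt_mate B x).symm)
  refine Nat.card_le_card_of_surjective φ ?_
  rintro ⟨p⟩
  exact ⟨Quot.mk _ (Quot.mk _ p), rfl⟩

/-- If no edge meets two boundary components of `(V, A)`, then `(V, A)` has at most `k(G)` of
them. -/
theorem f_le_k_univ [Finite V] [Fintype E]
    (h : ∀ x : Corner E, G.boundaryAt A x = G.boundaryAt A (mate (symmDiff A {x.1}) x)) :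
    G.f A ≤ G.k Finset.univ := by
  -- Of `across` and `along`, one is the mate for `A` and the other the mate after the toggle,
  -- whichever side `x.1` is on.
  have hboth : ∀ x : Corner E, G.boundaryAt A x.across = G.boundaryAt A x ∧
      G.boundaryAt A x.along = G.boundaryAt A x := by
    intro x
    have h₁ := (h x).symm
    have h₂ := G.boundaryAt_mate A x
    by_cases hx : x.1 ∈ A <;> simp only [mate, Finset.mem_symmDiff, Finset.mem_singleton, hx,
      not_true_eq_false, and_false, not_false_eq_true, or_self, or_true, and_self, if_true,
      if_false] at h₁ h₂
    · exact ⟨h₁, h₂⟩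
    · exact ⟨h₂, h₁⟩
  have hcircle : ∀ x y : Corner E, G.inc x.1 x.2.1 = G.inc y.1 y.2.1 →
      G.boundaryAt A x = G.boundaryAt A y := by
    intro x y hxy
    replace hxy := G.circle x y hxy
    induction hxy with
    | rel a b hab =>
      rcases hab with rfl | rfl
      · exact (G.boundaryAt_arc A a).symm
      · exact (hboth a).1.symm
    | refl a => rfl
    | symm a b _ ih => exact ih.symm
    | trans a b c _ _ ih₁ ih₂ => exact ih₁.trans ih₂
  -- All boundary points on one vertex disc share a boundary component, so any choice of point gives
  -- the same map.
  let s := Function.surjInv G.vertexAt_surjective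
  let g : V → G.BoundaryComponent A := fun v => Quot.mk _ (s v)
  have hg : ∀ p, g (G.vertexAt p) = Quot.mk _ p := by
    intro p
    have hs : G.vertexAt (s (G.vertexAt p)) = G.vertexAt p := Function.surjInv_eq _ _
    change Quot.mk _ (s (G.vertexAt p)) = _
    generalize s (G.vertexAt p) = q at hs
    rcases p with x | v <;> rcases q with y | w
    · exact hcircle y x hs
    · exact absurd hs.symm (w.2 _ _)
    · exact absurd hs (v.2 _ _)
    · rw [Subtype.ext (show w.1 = v.1 from hs)]
  refine Nat.card_le_card_of_surjective (Quot.lift g ?_ : G.Component Finset.univ → _) ?_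
  · rintro _ _ ⟨e, -, rfl, rfl⟩
    have h₁ := hg (Sum.inl (e, false, false))
    have h₂ := hg (Sum.inl (e, true, false))
    exact h₁.trans ((hboth (e, false, false)).2.symm.trans h₂.symm)
  · rintro ⟨p⟩
    exact ⟨Quot.mk _ (G.vertexAt p), hg p⟩

end mate

end RibbonGraph

/-! ### Toggle sequences and symmetric differences -/

namespace Toggles

variable {E : Type*} [DecidableEq E]

/-- `Toggles.step` appends at the end, while the inductions below choose the first toggle. -/
theorem prepend {n : ℕ} {A F : Finset E} (e : E) (h : Toggles n (symmDiff A {e}) F) :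
    Toggles (n + 1) A F := by
  generalize hB : symmDiff A {e} = B at h
  induction h with
  | refl B => subst hB; exact .step e (.refl A)
  | step e' _ ih => exact .step e' (ih hB)

theorem of_symmDiff (A F : Finset E) : Toggles (symmDiff A F).card A F := by
  generalize hn : (symmDiff A F).card = n
  induction n generalizing A with
  | zero =>
    rw [Finset.card_eq_zero, ← Finset.bot_eq_empty, symmDiff_eq_bot] at hn
    subst hn
    exact .refl A
  | succ n ih =>
    obtain ⟨e, he⟩ : (symmDiff A F).Nonempty := Finset.card_pos.1 (by omega)
    refine prepend e (ih _ ?_)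
    have : symmDiff (symmDiff A {e}) F = (symmDiff A F).erase e := by
      ext z
      by_cases hz : z = e
      · subst hz
        simp only [Finset.mem_symmDiff, Finset.mem_singleton, Finset.mem_erase] at he ⊢
        tauto
      · simp only [Finset.mem_symmDiff, Finset.mem_singleton, Finset.mem_erase, hz]
        tauto
    rw [this, Finset.card_erase_of_mem he, hn]
    rfl

theorem f_le {V : Type*} [Finite V] [Finite E] (G : RibbonGraph V E) {n : ℕ} {A F : Finset E}
    (h : Toggles n A F) : G.f A ≤ G.f F + n := by
  induction h with
  | refl => simp
  | @step n A B e _ ih =>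
    have := G.f_le_f_toggle_add_one B e
    omega

theorem card_symmDiff_le {n : ℕ} {A F : Finset E} (h : Toggles n A F) :
    (symmDiff A F).card ≤ n := by
  induction h with
  | refl => simp
  | @step n A B e _ ih =>
    rw [← symmDiff_assoc]
    have h₁ : symmDiff (symmDiff A B) {e} ⊆ symmDiff A B ∪ {e} := symmDiff_le_sup
    have h₂ := (Finset.card_le_card h₁).trans (Finset.card_union_le _ _)
    rw [Finset.card_singleton] at h₂
    omega

end Toggles

theorem RibbonGraph.exists_toggles_quasiTree {V E : Type*} [Finite V] [Fintype E] [DecidableEq E]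
    (G : RibbonGraph V E) (A : Finset E) :
    ∃ n F, G.IsSpanningQuasiTree F ∧ Toggles n A F ∧ n + G.k Finset.univ = G.f A := by
  induction hm : G.f A using Nat.strong_induction_on generalizing A with
  | _ m ih =>
    have hk := (G.k_univ_le_k A).trans (G.k_le_f A)
    by_cases h : G.f A ≤ G.k Finset.univ
    · exact ⟨0, A, (G.isSpanningQuasiTree_iff A).2 (by omega), .refl A, by omega⟩
    · obtain ⟨x, hx⟩ := not_forall.1 (mt (G.f_le_k_univ A) h)
      -- Together with the general bound, the drop in `f` is exactly one.
      have hlt := G.f_toggle_lt A rfl hx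
      have hle := G.f_le_f_toggle_add_one A x.1
      obtain ⟨n, F, hF, hT, hn⟩ := ih _ (hm ▸ hlt) _ rfl
      exact ⟨n + 1, F, hF, hT.prepend x.1, by omega⟩

theorem theoremt {V E : Type*} [Finite V] [Fintype E] [DecidableEq E]
    (G : RibbonGraph V E) :
    G.deltaMatroid.feasible.Nonempty ∧
    ∀ A : Finset E,
      G.deltaMatroid.rank A = (Fintype.card E : ℤ) - G.f A + G.k Finset.univ ∧
      IsLeast {m : ℤ | ∃ n : ℕ, m = n ∧ ∃ F : Finset E, G.IsSpanningQuasiTree F ∧ Toggles n A F}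
        ((Fintype.card E : ℤ) - G.deltaMatroid.rank A) := by
  refine ⟨?_, fun A => ?_⟩
  · obtain ⟨_, F, hF, -⟩ := G.exists_toggles_quasiTree ∅
    exact ⟨F, hF⟩
  obtain ⟨n, F, hF, hT, hn⟩ := G.exists_toggles_quasiTree A
  have hlow : ∀ m F', G.IsSpanningQuasiTree F' → Toggles m A F' → n ≤ m := by
    intro m F' hF' hT'
    have h₁ := hT'.f_le G
    rw [(G.isSpanningQuasiTree_iff F').1 hF'] at h₁
    omega
  -- A sequence of `n` toggles gives `|A ∆ F| ≤ n`; toggling the elements of `A ∆ F` one by one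
  -- gives the reverse bound.
  have hmin : IsLeast {n : ℕ | ∃ F ∈ G.deltaMatroid.feasible, n = (symmDiff A F).card} n := by
    refine ⟨⟨F, hF, le_antisymm (hlow _ F hF (.of_symmDiff A F)) hT.card_symmDiff_le⟩, ?_⟩
    rintro _ ⟨F', hF', rfl⟩
    exact hlow _ F' hF' (.of_symmDiff A F')
  have hrank : G.deltaMatroid.rank A = (Fintype.card E : ℤ) - n := by
    rw [SetSystem.rank, hmin.csInf_eq]
  refine ⟨by rw [hrank]; omega, ?_⟩
  rw [hrank, sub_sub_cancel]
  refine ⟨⟨n, rfl, F, hF, hT⟩, ?_⟩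
  rintro _ ⟨m, rfl, F', hF', hT'⟩
  exact_mod_cast hlow m F' hF' hT'
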